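/- Let $K$ be a number field, $v$ a finite place of $K$, $\Lambda$ the completion of $\mathcal O_K$ at $v$, $\eta=\operatorname{Spec} K_v$ the generic point of $\operatorname{Spec}\Lambda$, $k(v)$ the (finite) residue field, with $N(v)$ elements, and write $v=\operatorname{Spec} k(v)$ also for the closed point. Let $CH^p(-,n)$ be Bloch's higher Chow groups, defined by the simplicial cycle complex $z^p(-,\bullet)$, with $CH^p(-)=CH^p(-,0)$. Take $X=\eta$ (that is, $\operatorname{Spec} K$ at $v$) with model $\operatorname{Spec}\Lambda$. The $v$-adic Deligne cohomology group is $$H^1_{\mathcal D}(X_{/v},\mathbb Q(1))=CH^0(v)\otimes\mathbb Q .$$ (In general it is $\operatorname{Ker}(i^*i_*)/\operatorname{Im}(\gamma)\otimes\mathbb Q$ for the components of the special fibre; here $\gamma=0$ because the special fibre is irreducible, and $i^*i_*=0$ because $CH^1(\operatorname{Spec}\Lambda)=0$ and $CH^1(v)=0$.) Then the connecting relation of $z^0(v,\bullet)\to z^1(\operatorname{Spec}\Lambda,\bullet)\to z^1(\eta,\bullet)$ is the graph of a homomorphism $\partial: CH^1(\eta,1)\to CH^0(v)$, the boundary map of the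 localization sequence. Let the $v$-adic regulator be $r_{\mathcal D,v}: CH^1(\eta,1)\to H^1_{\mathcal D}(X_{/v},\mathbb Q(1))$, $x\mapsto \partial x\otimes 1$. The following hold. 1. $CH^1(\operatorname{Spec}\Lambda)=0$ and $CH^1(v)=0$. 2. $\partial$ is surjective, and so is the $\mathbb Q$-linear extension $r_{\mathcal D,v}\otimes\mathbb Q: CH^1(\eta,1)\otimes\mathbb Q\to H^1_{\mathcal D}(X_{/v},\mathbb Q(1))$. 3. $H^1_{\mathcal D}(X_{/v},\mathbb Q(1))$ has dimension $1$ over $\mathbb Q$, and the image of $r_{\mathcal D,v}$ is a full sublattice in it (a finitely generated subgroup that spans it over $\mathbb Q$), of rank $1$. 4. For every prime $\ell\nmid N(v)$, every embedding $\mathbb Q_\ell\hookrightarrow\mathbb C$ and every geometric Frobenius $F^*$ at $v$, the local $L$-factor is $$L_v(X,s):=\det\bigl(1-F^*N(v)^{-s}\,\big|\,H^0(\bar X,\mathbb Q_\ell)^{I}\bigr)^{-1}=\frac{1}{1-N(v)^{-s}},$$ where $\bar X=\operatorname{Spec}\overline{K_v}$ and $I$ is the inertia group. This function has a pole of order exactly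 $1$ at $s=0$, so the order of the pole is the rank of the image of $r_{\mathcal D,v}$. -/

import Mathlib

open scoped TensorProduct

noncomputable section

/-! ### The algebraic simplices -/

/-- The coordinate ring `A[t₀,…,tₙ] / (t₀ + ⋯ + tₙ - 1)` of the algebraic simplex `Δⁿ` over
`Spec A`. -/
abbrev SimplexRing (A : Type*) [CommRing A] (n : ℕ) : Type _ :=
  MvPolynomial (Fin (n + 1)) A ⧸
    Ideal.span {(∑ i, MvPolynomial.X i - 1 : MvPolynomial (Fin (n + 1)) A)}

namespace SimplexRing

variable (A : Type*) [CommRing A]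

/-- The barycentric coordinate `tᵢ` on `Δⁿ`. -/
def coord {n : ℕ} (i : Fin (n + 1)) : SimplexRing A n :=
  Ideal.Quotient.mk _ (MvPolynomial.X i)

theorem sum_coord (n : ℕ) : ∑ i : Fin (n + 1), coord A i = 1 := by
  have h : Ideal.Quotient.mk
      (Ideal.span {(∑ i, MvPolynomial.X i - 1 : MvPolynomial (Fin (n + 1)) A)})
      (∑ i, MvPolynomial.X i - 1) = 0 :=
    Ideal.Quotient.eq_zero_iff_mem.2 (Ideal.subset_span rfl)
  rw [map_sub, map_sum, map_one, sub_eq_zero] at h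
  exact h

/-- The map `Δᵐ → Δⁿ` attached to a map `φ` of vertices, on coordinate rings:
`tᵢ ↦ ∑_{φ j = i} tⱼ`. -/
def pull {m n : ℕ} (φ : Fin (m + 1) → Fin (n + 1)) : SimplexRing A n →ₐ[A] SimplexRing A m :=
  Ideal.Quotient.liftₐ _
    (MvPolynomial.aeval fun i => ∑ j, if φ j = i then coord A j else 0) (by
      intro a ha
      have hle : Ideal.span {(∑ i, MvPolynomial.X i - 1 : MvPolynomial (Fin (n + 1)) A)} ≤
          RingHom.ker (MvPolynomial.aeval
            fun i => ∑ j, if φ j = i then coord A j else 0 :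
              MvPolynomial (Fin (n + 1)) A →ₐ[A] SimplexRing A m) := by
        rw [Ideal.span_singleton_le_iff_mem, RingHom.mem_ker]
        simp only [map_sub, map_sum, MvPolynomial.aeval_X, map_one]
        rw [Finset.sum_comm]
        simp [sum_coord]
      exact hle ha)

/-- The change of base ring `A[Δⁿ] → B[Δⁿ]`. -/
def baseMap (B : Type*) [CommRing B] [Algebra A B] (n : ℕ) :
    SimplexRing A n →+* SimplexRing B n :=
  Ideal.quotientMap _ (MvPolynomial.map (algebraMap A B)) (by
    rw [Ideal.span_singleton_le_iff_mem, Ideal.mem_comap]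
    have h : MvPolynomial.map (algebraMap A B)
        (∑ i, MvPolynomial.X i - 1 : MvPolynomial (Fin (n + 1)) A) =
        ∑ i, MvPolynomial.X i - 1 := by
      simp
    rw [h]
    exact Ideal.subset_span rfl)

end SimplexRing

/-! ### Bloch's cycle complex of `Spec A` -/

/-- The irreducible closed subsets (given by their generic points) of codimension `p` in
`Spec A × Δⁿ` that meet every face `Spec A × F` properly, that is, in codimension at least `p`
in `Spec A × F`. -/
def AdmissiblePrime (A : Type*) [CommRing A] (p n : ℕ) : Type _ :=
  {P : PrimeSpectrum (SimplexRing A n) // P.asIdeal.height = p ∧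
    ∀ (m : ℕ) (φ : Fin (m + 1) ↪o Fin (n + 1)) (Q : PrimeSpectrum (SimplexRing A m)),
      P.asIdeal ≤ Q.asIdeal.comap (SimplexRing.pull A φ) → (p : ℕ∞) ≤ Q.asIdeal.height}

/-- The group `z^p(Spec A, n)` of admissible cycles. -/
abbrev AdmissibleCycle (A : Type*) [CommRing A] (p n : ℕ) : Type _ :=
  AdmissiblePrime A p n →₀ ℤ

namespace AdmissibleCycle

variable (A : Type*) [CommRing A]

/-- The multiplicity of the prime `Q` in the cycle of the closed subscheme `V(I)`: the length of
the local ring of `V(I)` at `Q`. -/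
def multiplicity {B : Type*} [CommRing B] (I : Ideal B) (Q : PrimeSpectrum B) : ℕ :=
  (Module.length (Localization.AtPrime Q.asIdeal)
    (Localization.AtPrime Q.asIdeal ⧸
      I.map (algebraMap B (Localization.AtPrime Q.asIdeal)))).toNat

theorem le_of_multiplicity_ne_zero {B : Type*} [CommRing B] {I : Ideal B} {Q : PrimeSpectrum B}
    (h : multiplicity I Q ≠ 0) : I ≤ Q.asIdeal := by
  by_contra hI
  apply h
  obtain ⟨x, hxI, hxQ⟩ := Set.not_subset.1 hI
  have htop : I.map (algebraMap B (Localization.AtPrime Q.asIdeal)) = ⊤ :=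
    Ideal.eq_top_of_isUnit_mem _ (Ideal.mem_map_of_mem _ hxI)
      (IsLocalization.map_units (Localization.AtPrime Q.asIdeal)
        (⟨x, hxQ⟩ : Q.asIdeal.primeCompl))
  have : Subsingleton (Localization.AtPrime Q.asIdeal ⧸
      I.map (algebraMap B (Localization.AtPrime Q.asIdeal))) :=
    Ideal.Quotient.subsingleton_iff.2 htop
  simp [multiplicity, Module.length_eq_zero]

variable [IsNoetherianRing A]

theorem finite_support_face {p n : ℕ} (i : Fin (n + 2)) (P : AdmissiblePrime A p (n + 1)) :
    (Function.support fun Q : AdmissiblePrime A p n =>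
      (multiplicity (P.1.asIdeal.map (SimplexRing.pull A i.succAbove)) Q.1 : ℤ)).Finite := by
  set I := P.1.asIdeal.map (SimplexRing.pull A i.succAbove) with hI
  refine Set.Finite.of_finite_image
    (f := fun Q : AdmissiblePrime A p n => Q.1.asIdeal)
    ((I.finite_minimalPrimes_of_isNoetherianRing _).subset ?_) ?_
  · rintro _ ⟨Q, hQ, rfl⟩
    have hle : I ≤ Q.1.asIdeal :=
      le_of_multiplicity_ne_zero (by simpa using hQ)
    obtain ⟨M, hM, hMQ⟩ := Ideal.exists_minimalPrimes_le hle
    have hMp : M.IsPrime := hM.1.1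
    have hh : (p : ℕ∞) ≤ M.height :=
      P.2.2 n (Fin.succAboveOrderEmb i) ⟨M, hMp⟩ (Ideal.map_le_iff_le_comap.1 hM.1.2)
    rcases hMQ.eq_or_lt with h | h
    · exact Set.mem_of_eq_of_mem h.symm hM
    · exfalso
      have hlt : M.height < Q.1.asIdeal.height := by
        have : Q.1.asIdeal.IsPrime := Q.1.isPrime
        exact Ideal.height_strict_mono_of_isPrime_of_isPrime h
      rw [Q.2.1] at hlt
      exact absurd hh (not_le.2 hlt)
  · intro Q _ Q' _ h
    exact Subtype.ext (PrimeSpectrum.ext h)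

/-- The `i`-th face map `z^p(Spec A, n+1) → z^p(Spec A, n)`, the intersection with the face
`tᵢ = 0`. Since `tᵢ` is a nonzerodivisor on the coordinate ring of an admissible subvariety, the
intersection multiplicities are the lengths of the scheme-theoretic intersection. -/
def face (p n : ℕ) (i : Fin (n + 2)) : AdmissibleCycle A p (n + 1) →+ AdmissibleCycle A p n :=
  Finsupp.liftAddHom fun P => (zmultiplesHom _)
    (Finsupp.ofSupportFinite _ (finite_support_face A i P))

/-- The differential `∑ (-1)ⁱ ∂ᵢ` of Bloch's cycle complex. -/
def differential (p n : ℕ) : AdmissibleCycle A p (n + 1) →+ AdmissibleCycle A p n :=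
  ∑ i : Fin (n + 2), (-1 : ℤ) ^ (i : ℕ) • face A p n i

/-- The kernel of the differential in simplicial degree `n`. -/
def closedCycles (p : ℕ) : (n : ℕ) → AddSubgroup (AdmissibleCycle A p n)
  | 0 => ⊤
  | n + 1 => (differential A p n).ker

/-- A cycle as a finitely supported function on all points of `Spec A × Δⁿ`. -/
def toPoints {A : Type*} [CommRing A] {p n : ℕ} (c : AdmissibleCycle A p n) :
    PrimeSpectrum (SimplexRing A n) →₀ ℤ :=
  c.mapDomain Subtype.val

end AdmissibleCycle

/-- Bloch's higher Chow group `CH^p(Spec A, n)`, the `n`-th homology of the cycle complex. In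
particular `HigherChow A p 0` is the Chow group `CH^p(Spec A)`. -/
abbrev HigherChow (A : Type*) [CommRing A] [IsNoetherianRing A] (p n : ℕ) : Type _ :=
  AdmissibleCycle.closedCycles A p n ⧸
    (AdmissibleCycle.differential A p n).range.addSubgroupOf
      (AdmissibleCycle.closedCycles A p n)

/-! ### The boundary map of the localization sequence -/

section Localization

variable (R : Type*) [CommRing R] [IsDomain R] [IsDiscreteValuationRing R]
  (F : Type*) [Field F] [Algebra R F] [IsFractionRing R F]

/-- For a discrete valuation ring `R` with closed point `v` and generic point `η`, the relation
"`y` is the boundary of `x`" between `x ∈ CH^{p+1}(η, n+1)` and `y ∈ CH^p(v, n)`: the class `x` is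
represented by the restriction `j^* z` to the generic fibre of some `z ∈ z^{p+1}(Spec R, n+1)`
whose differential is the push-forward `i_* w` from the special fibre of a cycle `w` that
represents `y`. -/
def LocalizationRel (p n : ℕ) (x : HigherChow F (p + 1) (n + 1))
    (y : HigherChow (IsLocalRing.ResidueField R) p n) : Prop :=
  ∃ (z : AdmissibleCycle R (p + 1) (n + 1))
    (ξ : AdmissibleCycle.closedCycles F (p + 1) (n + 1))
    (w : AdmissibleCycle.closedCycles (IsLocalRing.ResidueField R) p n),
    x = (ξ : HigherChow F (p + 1) (n + 1)) ∧
    y = (w : HigherChow (IsLocalRing.ResidueField R) p n) ∧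
    (∀ Q : PrimeSpectrum (SimplexRing F (n + 1)),
      ξ.1.toPoints Q =
        z.toPoints (PrimeSpectrum.comap (SimplexRing.baseMap R F (n + 1)) Q)) ∧
    (AdmissibleCycle.differential R (p + 1) n z).toPoints =
      w.1.toPoints.mapDomain
        (PrimeSpectrum.comap (SimplexRing.baseMap R (IsLocalRing.ResidueField R) n))

/-- `bd` is the connecting homomorphism `CH^1(η, 1) → CH^0(v)` of the long exact sequence attached
to `z^0(v, •) → z^1(Spec R, •) → z^1(η, •)`. -/
def IsLocalizationBoundary
    (bd : HigherChow F 1 1 →+ HigherChow (IsLocalRing.ResidueField R) 0 0) : Prop :=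
  ∀ x y, bd x = y ↔ LocalizationRel R F 0 0 x y

/-- The `v`-adic Deligne cohomology `H^1_𝒟(X_{/v}, ℚ(1))` of `X = Spec F` with model `Spec R`. The
special fibre `Y = Spec k(v)` is smooth and irreducible, so `Y^(1) = Y` and `Y^(2) = ∅`, and
`i^* i_* : CH^0(Y) → CH^1(Spec R) → CH^1(Y)` is zero because `Y` is a principal divisor (both groups
on the right even vanish); hence `Ker(i^* i_*) / Im(γ) ⊗ ℚ` is `CH^0(v) ⊗ ℚ`. -/
abbrev DeligneH1 : Type _ :=
  ℚ ⊗[ℤ] HigherChow (IsLocalRing.ResidueField R) 0 0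

/-- The `v`-adic regulator `CH^1(η, 1) → H^1_𝒟(X_{/v}, ℚ(1))` given by the boundary map `bd`. -/
def regulator (bd : HigherChow F 1 1 →+ HigherChow (IsLocalRing.ResidueField R) 0 0) :
    HigherChow F 1 1 →ₗ[ℤ] DeligneH1 R :=
  (TensorProduct.mk ℤ ℚ (HigherChow (IsLocalRing.ResidueField R) 0 0) 1).comp bd.toIntLinearMap

/-- The `ℚ`-linear extension `CH^1(η, 1) ⊗ ℚ → H^1_𝒟(X_{/v}, ℚ(1))` of the regulator. -/
def rationalRegulator (bd : HigherChow F 1 1 →+ HigherChow (IsLocalRing.ResidueField R) 0 0) :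
    (ℚ ⊗[ℤ] HigherChow F 1 1) →ₗ[ℚ] DeligneH1 R :=
  bd.toIntLinearMap.baseChange ℚ

end Localization

/-- A full sublattice of a rational vector space: a finitely generated subgroup that spans it. -/
def IsFullSublattice {V : Type*} [AddCommGroup V] [Module ℚ V] (M : Submodule ℤ V) : Prop :=
  M.FG ∧ Submodule.span ℚ (M : Set V) = ⊤

/-! ### The local `L`-factor of `H^0` -/

section LFactor

/-- `H^0(Spec E, ℚ_ℓ)`: the global sections of the constant sheaf, that is, the locally constant
functions with values in `ℚ_ℓ`. -/
abbrev EllAdicH0 (E : Type*) [CommRing E] (ℓ : ℕ) [Fact ℓ.Prime] : Type _ :=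
  LocallyConstant (PrimeSpectrum E) ℚ_[ℓ]

variable (R : Type*) [CommRing R] [IsDomain R] [IsDiscreteValuationRing R]
  (F : Type*) [Field F] [Algebra R F] [IsFractionRing R F]

/-- The action of the absolute Galois group of `F` on `H^0(X̄, ℚ_ℓ)` for `X = Spec F`. -/
def galoisAction (ℓ : ℕ) [Fact ℓ.Prime]
    (σ : AlgebraicClosure F ≃ₐ[F] AlgebraicClosure F) :
    EllAdicH0 (AlgebraicClosure F) ℓ →ₗ[ℚ_[ℓ]] EllAdicH0 (AlgebraicClosure F) ℓ :=
  LocallyConstant.comapₗ ℚ_[ℓ]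
    ⟨PrimeSpectrum.comap (σ : AlgebraicClosure F →+* AlgebraicClosure F),
      PrimeSpectrum.continuous_comap _⟩

theorem galoisAction_mul (ℓ : ℕ) [Fact ℓ.Prime]
    (σ τ : AlgebraicClosure F ≃ₐ[F] AlgebraicClosure F)
    (f : EllAdicH0 (AlgebraicClosure F) ℓ) :
    galoisAction F ℓ (σ * τ) f = galoisAction F ℓ σ (galoisAction F ℓ τ f) := by
  ext x
  rfl

/-- The nonunits of the integral closure of `R` in the algebraic closure of `F`; if `R` is complete,
these form its maximal ideal. -/
def integralNonunits : Set (AlgebraicClosure F) :=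
  {x | IsIntegral R x ∧ ¬ (x ≠ 0 ∧ IsIntegral R x⁻¹)}

/-- The inertia group: the automorphisms that act trivially on the residue field of the integral
closure of `R`. -/
def inertia : Set (AlgebraicClosure F ≃ₐ[F] AlgebraicClosure F) :=
  {σ | ∀ x, IsIntegral R x → σ x - x ∈ integralNonunits R F}

/-- `σ` is a geometric Frobenius: its inverse acts as `x ↦ x ^ N(v)` on the residue field of the
integral closure of `R`. -/
def IsGeometricFrobenius (σ : AlgebraicClosure F ≃ₐ[F] AlgebraicClosure F) : Prop :=
  ∀ x, IsIntegral R x →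
    σ⁻¹ x - x ^ Nat.card (IsLocalRing.ResidueField R) ∈ integralNonunits R F

variable {F} in
theorem isIntegral_galois_iff (σ : AlgebraicClosure F ≃ₐ[F] AlgebraicClosure F)
    (x : AlgebraicClosure F) : IsIntegral R (σ x) ↔ IsIntegral R x :=
  isIntegral_algEquiv (σ.restrictScalars R)

variable {F} in
theorem galois_mem_integralNonunits (σ : AlgebraicClosure F ≃ₐ[F] AlgebraicClosure F)
    {x : AlgebraicClosure F} (hx : x ∈ integralNonunits R F) : σ x ∈ integralNonunits R F := by
  refine ⟨(isIntegral_galois_iff R σ x).2 hx.1, fun h => hx.2 ⟨?_, ?_⟩⟩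
  · rintro rfl
    exact h.1 (map_zero σ)
  · exact (isIntegral_galois_iff R σ x⁻¹).1 (by simpa using h.2)

/-- The inertia invariants `H^0(X̄, ℚ_ℓ)^I`. -/
def inertiaInvariants (ℓ : ℕ) [Fact ℓ.Prime] :
    Submodule ℚ_[ℓ] (EllAdicH0 (AlgebraicClosure F) ℓ) where
  carrier := {f | ∀ σ ∈ inertia R F, galoisAction F ℓ σ f = f}
  add_mem' hf hg σ hσ := by rw [map_add, hf σ hσ, hg σ hσ]
  zero_mem' σ _ := map_zero _
  smul_mem' c f hf σ hσ := by rw [map_smul, hf σ hσ]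

theorem galoisAction_mem_inertiaInvariants (ℓ : ℕ) [Fact ℓ.Prime]
    (σ : AlgebraicClosure F ≃ₐ[F] AlgebraicClosure F) :
    ∀ f ∈ inertiaInvariants R F ℓ, galoisAction F ℓ σ f ∈ inertiaInvariants R F ℓ := by
  intro f hf τ hτ
  have hconj : σ⁻¹ * τ * σ ∈ inertia R F := by
    intro x hx
    have h := galois_mem_integralNonunits R σ⁻¹
      (hτ (σ x) ((isIntegral_galois_iff R σ x).2 hx))
    have e : σ⁻¹ (τ (σ x) - σ x) = (σ⁻¹ * τ * σ) x - x := by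
      rw [map_sub]
      congr 1
      exact σ.symm_apply_apply x
    rwa [e] at h
  have e : τ * σ = σ * (σ⁻¹ * τ * σ) := by group
  rw [← galoisAction_mul, e, galoisAction_mul, hf _ hconj]

/-- The local `L`-factor `L_v(X, s) = det(1 - σ N(v)^{-s} | H^0(X̄, ℚ_ℓ)^I)⁻¹` of `X = Spec F`, where
`σ` is a geometric Frobenius and the `ℓ`-adic coefficients are carried into `ℂ` by `ι`. -/
def localLFactor (ℓ : ℕ) [Fact ℓ.Prime] (ι : ℚ_[ℓ] →+* ℂ)
    (σ : AlgebraicClosure F ≃ₐ[F] AlgebraicClosure F) (s : ℂ) : ℂ :=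
  letI := ι.toAlgebra
  (LinearMap.det (LinearMap.id -
    ((Nat.card (IsLocalRing.ResidueField R) : ℂ) ^ (-s)) •
      (((galoisAction F ℓ σ).restrict
        (galoisAction_mem_inertiaInvariants R F ℓ σ)).baseChange ℂ)))⁻¹

end LFactor

end

/-!
An irreducible divisor on `Δ¹` over `A` that avoids both vertices has an equation `f`, unique up to
a unit. Units on a simplex are constant, so `f(1) / f(0)` depends only on the divisor. It is
multiplicative in the divisor and telescopes to `1` on the three faces of a divisor on `Δ²`; over a
field `F` this gives a homomorphism `CH¹(F, 1) → Fˣ`, which is onto because the linear function with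
the values `1` and `a` at the ends of `Δ¹` goes to `a`.

Over a discrete valuation ring `R` with fraction field `F`, the boundary of the divisor of `f` is
`ord f(1) - ord f(0)` times the closed point, that is, the order of `f(1) / f(0)`. Restriction to
the generic fibre forgets only the vertical divisors; they have constant equations, so their ratio
is `1`. Hence the connecting relation is the graph of the composite of `CH¹(F, 1) → Fˣ`, the
valuation of `F`, and `ℤ ≃ CH⁰(v)`; the uniformizers give the surjectivity.

On the side of the `L`-factor, `Spec F̄` is a point, so `H⁰` is a line with trivial Galois action.
-/

noncomputable section

namespace SimplexRing

variable {A : Type*} [CommRing A]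

/-! ### Functions on the simplices -/

theorem ringHom_ext {B : Type*} [Semiring B] {n : ℕ} {f g : SimplexRing A n →+* B}
    (hC : ∀ a : A, f (algebraMap A _ a) = g (algebraMap A _ a))
    (hX : ∀ i, f (coord A i) = g (coord A i)) : f = g :=
  Ideal.Quotient.ringHom_ext (MvPolynomial.ringHom_ext hC hX)

theorem algHom_ext {B : Type*} [Semiring B] [Algebra A B] {n : ℕ} {f g : SimplexRing A n →ₐ[A] B}
    (hX : ∀ i, f (coord A i) = g (coord A i)) : f = g :=
  Ideal.Quotient.algHom_ext _ (MvPolynomial.algHom_ext hX)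

variable (A) in
/-- The map out of the coordinate ring of `Δⁿ` given by `n + 1` elements with sum one. -/
def lift {B : Type*} [CommRing B] [Algebra A B] {n : ℕ} (b : Fin (n + 1) → B) (hb : ∑ i, b i = 1) :
    SimplexRing A n →ₐ[A] B :=
  Ideal.Quotient.liftₐ _ (MvPolynomial.aeval b) fun a ha => by
    have hle : Ideal.span {(∑ i, MvPolynomial.X i - 1 : MvPolynomial (Fin (n + 1)) A)} ≤
        RingHom.ker (MvPolynomial.aeval b : MvPolynomial (Fin (n + 1)) A →ₐ[A] B) := by
      rw [Ideal.span_singleton_le_iff_mem, RingHom.mem_ker]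
      simp [hb]
    exact hle ha

@[simp]
theorem lift_coord {B : Type*} [CommRing B] [Algebra A B] {n : ℕ} (b : Fin (n + 1) → B)
    (hb : ∑ i, b i = 1) (i : Fin (n + 1)) : lift A b hb (coord A i) = b i :=
  MvPolynomial.aeval_X b i

@[simp]
theorem pull_coord {m n : ℕ} (φ : Fin (m + 1) → Fin (n + 1)) (i : Fin (n + 1)) :
    pull A φ (coord A i) = ∑ j, if φ j = i then coord A j else 0 :=
  MvPolynomial.aeval_X _ i

section baseMap

variable (B : Type*) [CommRing B] [Algebra A B] (n : ℕ)

@[simp]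
theorem baseMap_coord (i : Fin (n + 1)) : baseMap A B n (coord A i) = coord B i := by
  simp [baseMap, coord]

@[simp]
theorem baseMap_algebraMap (a : A) :
    baseMap A B n (algebraMap A _ a) = algebraMap B _ (algebraMap A B a) := by
  change Ideal.quotientMap _ _ _ (Ideal.Quotient.mk _ (MvPolynomial.C a)) = _
  rw [Ideal.quotientMap_mk, MvPolynomial.map_C]
  rfl

end baseMap

variable (A) in
/-- The value of a function on `Δⁿ` at the `j`-th vertex. -/
def vertex {n : ℕ} (j : Fin (n + 1)) : SimplexRing A n →ₐ[A] A :=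
  lift A (Pi.single j 1) (by simp)

@[simp]
theorem vertex_coord {n : ℕ} (i j : Fin (n + 1)) :
    vertex A j (coord A i) = if i = j then 1 else 0 := by
  simp [vertex, Pi.single_apply]

@[simp]
theorem vertex_pull {m n : ℕ} (φ : Fin (m + 1) → Fin (n + 1)) (j : Fin (m + 1))
    (x : SimplexRing A n) : vertex A j (pull A φ x) = vertex A (φ j) x := by
  have : (vertex A j).comp (pull A φ) = vertex A (φ j) := by
    refine algHom_ext fun i => ?_
    rw [AlgHom.comp_apply, pull_coord, map_sum, Finset.sum_eq_single j]
    · simp [apply_ite (vertex A j), eq_comm]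
    · intro k _ hk
      simp [apply_ite (vertex A j), hk]
    · simp
  exact DFunLike.congr_fun this x

@[simp]
theorem vertex_baseMap {B : Type*} [CommRing B] [Algebra A B] {n : ℕ} (j : Fin (n + 1))
    (x : SimplexRing A n) : vertex B j (baseMap A B n x) = algebraMap A B (vertex A j x) := by
  have : (vertex B j : SimplexRing B n →+* B).comp (baseMap A B n) =
      (algebraMap A B).comp (vertex A j : SimplexRing A n →+* A) :=
    ringHom_ext (fun a => by simp) fun i => by simp [apply_ite (algebraMap A B)]
  exact DFunLike.congr_fun this x

theorem ne_zero_of_vertex_ne_zero {n : ℕ} {f : SimplexRing A n} {j : Fin (n + 1)}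
    (h : vertex A j f ≠ 0) : f ≠ 0 := by
  rintro rfl
  exact h (map_zero _)

theorem pull_ne_zero {m n : ℕ} {f : SimplexRing A n} (h : ∀ j, vertex A j f ≠ 0)
    (φ : Fin (m + 1) → Fin (n + 1)) : pull A φ f ≠ 0 :=
  ne_zero_of_vertex_ne_zero (j := 0) (by simpa only [vertex_pull] using h (φ 0))

theorem algebraMap_vertex_zero (x : SimplexRing A 0) : algebraMap A _ (vertex A 0 x) = x := by
  have : (Algebra.ofId A (SimplexRing A 0)).comp (vertex A 0) = AlgHom.id A _ := by
    refine algHom_ext fun i => ?_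
    have h : coord A (0 : Fin (0 + 1)) = 1 :=
      (Fin.sum_univ_one (coord A)).symm.trans (sum_coord A 0)
    obtain rfl : i = 0 := Fin.fin_one_eq_zero i
    simp [h]
  exact DFunLike.congr_fun this x

variable (A) in
/-- `Δ⁰` is the base: the coordinate ring of `Δ⁰` is identified with `A` by the value at the
vertex. -/
def equivZero : SimplexRing A 0 ≃ₐ[A] A :=
  AlgEquiv.ofAlgHom (vertex A 0) (Algebra.ofId A _) (by ext)
    (AlgHom.ext algebraMap_vertex_zero)

variable (A) in
/-- `Δⁿ` is the affine space with the coordinates `t₁, …, tₙ`. -/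
def equivMvPolynomial (n : ℕ) : SimplexRing A n ≃ₐ[A] MvPolynomial (Fin n) A :=
  AlgEquiv.ofAlgHom
    (lift A (Fin.cons (1 - ∑ i, MvPolynomial.X i) MvPolynomial.X) (by simp [Fin.sum_univ_succ]))
    (MvPolynomial.aeval fun i => coord A i.succ)
    (MvPolynomial.algHom_ext fun i => by simp)
    (algHom_ext fun i => by
      refine Fin.cases ?_ (fun i => ?_) i
      · have h := sum_coord A n
        rw [Fin.sum_univ_succ, ← eq_sub_iff_add_eq] at h
        simp [h]
      · simp)

theorem equivMvPolynomial_algebraMap (n : ℕ) (a : A) :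
    equivMvPolynomial A n (algebraMap A _ a) = MvPolynomial.C a :=
  (equivMvPolynomial A n).commutes a

theorem equivMvPolynomial_baseMap (B : Type*) [CommRing B] [Algebra A B] (n : ℕ)
    (x : SimplexRing A n) :
    equivMvPolynomial B n (baseMap A B n x) =
      MvPolynomial.map (algebraMap A B) (equivMvPolynomial A n x) := by
  have : ((equivMvPolynomial B n).toRingEquiv.toRingHom).comp (baseMap A B n) =
      (MvPolynomial.map (algebraMap A B)).comp (equivMvPolynomial A n).toRingEquiv.toRingHom := by
    refine ringHom_ext (fun a => ?_) fun i => ?_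
    · simp [MvPolynomial.algebraMap_eq]
    · refine Fin.cases ?_ (fun i => ?_) i <;> simp [equivMvPolynomial]
  exact DFunLike.congr_fun this x

theorem prime_algebraMap {a : A} (ha : Prime a) (n : ℕ) :
    Prime (algebraMap A (SimplexRing A n) a) := by
  rw [← MulEquiv.prime_iff (equivMvPolynomial A n), equivMvPolynomial_algebraMap]
  exact (MvPolynomial.prime_C_iff (Fin n)).2 ha

theorem vertex_eq_of_isUnit [IsReduced A] {n : ℕ} {u : SimplexRing A n} (hu : IsUnit u)
    (i j : Fin (n + 1)) : vertex A i u = vertex A j u := by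
  obtain ⟨a, -, ha⟩ := MvPolynomial.isUnit_iff_eq_C_of_isReduced.1 (hu.map (equivMvPolynomial A n))
  obtain rfl : u = algebraMap A _ a :=
    (equivMvPolynomial A n).injective (ha.trans (equivMvPolynomial_algebraMap n a).symm)
  simp

instance [IsDomain A] (n : ℕ) : IsDomain (SimplexRing A n) :=
  (equivMvPolynomial A n).toMulEquiv.isDomain _

instance [IsDomain A] [UniqueFactorizationMonoid A] (n : ℕ) :
    UniqueFactorizationMonoid (SimplexRing A n) :=
  (equivMvPolynomial A n).symm.toMulEquiv.uniqueFactorizationMonoid inferInstance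

theorem isLocalization_baseMap (M : Submonoid A) (B : Type*) [CommRing B] [Algebra A B]
    [IsLocalization M B] (n : ℕ) :
    letI := (baseMap A B n).toAlgebra
    IsLocalization (M.map (algebraMap A (SimplexRing A n))) (SimplexRing B n) := by
  let := (baseMap A B n).toAlgebra
  let := MvPolynomial.algebraMvPolynomial (R := A) (S := B) (σ := Fin n)
  let e := (equivMvPolynomial A n).toRingEquiv.symm
  let : Algebra (SimplexRing A n) (MvPolynomial (Fin n) B) :=
    ((algebraMap (MvPolynomial (Fin n) A) (MvPolynomial (Fin n) B)).comp
      e.symm.toRingHom).toAlgebra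
  have hM : (M.map (MvPolynomial.C (σ := Fin n))).map e =
      M.map (algebraMap A (SimplexRing A n)) :=
    SetLike.coe_injective <| (Set.image_image _ _ _).trans <|
      Set.image_congr fun a _ => (equivMvPolynomial A n).symm.commutes a
  have hloc : IsLocalization (M.map (algebraMap A (SimplexRing A n))) (MvPolynomial (Fin n) B) :=
    hM ▸ IsLocalization.isLocalization_of_base_ringEquiv
      (M.map (MvPolynomial.C (σ := Fin n))) (MvPolynomial (Fin n) B) e
  refine IsLocalization.isLocalization_of_algEquiv _
    (AlgEquiv.ofRingEquiv (f := (equivMvPolynomial B n).toRingEquiv.symm) fun x => ?_)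
  exact (equivMvPolynomial B n).symm_apply_eq.2 (equivMvPolynomial_baseMap B n x).symm

section vertexRatio

variable (K : Type*) [Field K] [Algebra A K]

/-- The quotient `f(1) / f(0)` of the values of a function `f` at the two ends of `Δ¹`. It has the
junk value `0` if `f(0) = 0`. -/
def vertexRatio : SimplexRing A 1 →*₀ K where
  toFun f := algebraMap A K (vertex A 1 f) / algebraMap A K (vertex A 0 f)
  map_zero' := by simp
  map_one' := by simp
  map_mul' f g := by simp only [map_mul, mul_div_mul_comm]

theorem vertexRatio_apply (f : SimplexRing A 1) :
    vertexRatio K f = algebraMap A K (vertex A 1 f) / algebraMap A K (vertex A 0 f) :=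
  rfl

theorem vertexRatio_ne_zero [FaithfulSMul A K] {f : SimplexRing A 1}
    (hf : ∀ j, vertex A j f ≠ 0) : vertexRatio K f ≠ 0 := by
  simp [vertexRatio_apply, hf]

theorem vertexRatio_of_isUnit [IsReduced A] {u : SimplexRing A 1} (hu : IsUnit u) :
    vertexRatio K u = 1 := by
  rw [vertexRatio_apply, vertex_eq_of_isUnit hu 1 0, div_self]
  exact ((hu.map (vertex A 0)).map (algebraMap A K)).ne_zero

theorem vertexRatio_algebraMap [FaithfulSMul A K] {a : A} (ha : a ≠ 0) :
    vertexRatio K (algebraMap A (SimplexRing A 1) a) = 1 := by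
  simp [vertexRatio_apply, ha]

theorem vertexRatio_pull {n : ℕ} (φ : Fin 2 → Fin (n + 1)) (f : SimplexRing A n) :
    vertexRatio K (pull A φ f) =
      algebraMap A K (vertex A (φ 1) f) / algebraMap A K (vertex A (φ 0) f) := by
  simp [vertexRatio_apply]

theorem vertexRatio_baseMap (f : SimplexRing A 1) :
    vertexRatio K (baseMap A K 1 f) = vertexRatio K f := by
  simp [vertexRatio_apply]

end vertexRatio

/-- The linear function on `Δ¹` with the values `1` and `a` at the ends. -/
def linearFunction (a : A) : SimplexRing A 1 :=
  coord A 0 + a • coord A 1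

@[simp]
theorem vertex_zero_linearFunction (a : A) : vertex A 0 (linearFunction a) = 1 := by
  simp [linearFunction]

@[simp]
theorem vertex_one_linearFunction (a : A) : vertex A 1 (linearFunction a) = a := by
  simp [linearFunction]

theorem vertex_linearFunction_ne_zero [Nontrivial A] {a : A} (ha : a ≠ 0) (j : Fin 2) :
    vertex A j (linearFunction a) ≠ 0 := by
  fin_cases j
  · exact (vertex_zero_linearFunction a).trans_ne one_ne_zero
  · exact (vertex_one_linearFunction a).trans_ne ha

theorem vertexRatio_linearFunction (K : Type*) [Field K] [Algebra A K] (a : A) :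
    vertexRatio K (linearFunction a) = algebraMap A K a := by
  simp [vertexRatio_apply]

end SimplexRing

/-! ### Divisors -/

namespace AdmissibleCycle

section toPoints

variable {A : Type*} [CommRing A] {p n : ℕ}

theorem toPoints_single (P : AdmissiblePrime A p n) (m : ℤ) :
    toPoints (Finsupp.single P m) = Finsupp.single P.1 m :=
  Finsupp.mapDomain_single

theorem toPoints_val (c : AdmissibleCycle A p n) (P : AdmissiblePrime A p n) :
    c.toPoints P.1 = c P :=
  Finsupp.mapDomain_apply Subtype.val_injective c P

end toPoints

section multiplicity

variable {B : Type*} [CommRing B]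

theorem multiplicity_self (Q : PrimeSpectrum B) : multiplicity Q.asIdeal Q = 1 := by
  rw [multiplicity, Localization.AtPrime.map_eq_maximalIdeal]
  have : IsSimpleModule (Localization.AtPrime Q.asIdeal) (Localization.AtPrime Q.asIdeal ⧸
      IsLocalRing.maximalIdeal (Localization.AtPrime Q.asIdeal)) :=
    isSimpleModule_iff_isCoatom.2 (IsLocalRing.maximalIdeal.isMaximal _).1
  rw [Module.length_eq_one]
  rfl

theorem multiplicity_span_singleton (f : B) (Q : PrimeSpectrum B) :
    multiplicity (Ideal.span {f}) Q =
      (Ring.ord (Localization.AtPrime Q.asIdeal) (algebraMap _ _ f)).toNat := by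
  rw [multiplicity, Ideal.map_span, Set.image_singleton]
  rfl

theorem multiplicity_eq_zero_of_notMem {f : B} {Q : PrimeSpectrum B} (h : f ∉ Q.asIdeal) :
    multiplicity (Ideal.span {f}) Q = 0 := by
  by_contra h0
  exact h (le_of_multiplicity_ne_zero h0 (Ideal.mem_span_singleton_self f))

theorem multiplicity_eq_zero_of_isUnit {f : B} (hf : IsUnit f) (Q : PrimeSpectrum B) :
    multiplicity (Ideal.span {f}) Q = 0 :=
  multiplicity_eq_zero_of_notMem fun h =>
    Q.isPrime.ne_top (Ideal.eq_top_of_isUnit_mem _ h hf)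

theorem multiplicity_span_mul [IsDomain B] [IsNoetherianRing B] {f g : B} (hf : f ≠ 0)
    (hg : g ≠ 0) {Q : PrimeSpectrum B} (hQ : Q.asIdeal.height ≤ 1) :
    multiplicity (Ideal.span {f * g}) Q =
      multiplicity (Ideal.span {f}) Q + multiplicity (Ideal.span {g}) Q := by
  have hdim : Ring.KrullDimLE 1 (Localization.AtPrime Q.asIdeal) := by
    rw [Ring.krullDimLE_iff, IsLocalization.AtPrime.ringKrullDim_eq_height Q.asIdeal]
    exact_mod_cast hQ
  have hinj : Function.Injective (algebraMap B (Localization.AtPrime Q.asIdeal)) :=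
    IsLocalization.injective _ Q.asIdeal.primeCompl_le_nonZeroDivisors
  have hregular {x : B} (hx : x ≠ 0) :
      algebraMap B (Localization.AtPrime Q.asIdeal) x ∈
        nonZeroDivisors (Localization.AtPrime Q.asIdeal) :=
    mem_nonZeroDivisors_of_ne_zero ((map_ne_zero_iff _ hinj).2 hx)
  simp only [multiplicity_span_singleton, map_mul]
  rw [Ring.ord_mul _ (hregular hg),
    ENat.toNat_add (Ring.ord_ne_top (hregular hf)) (Ring.ord_ne_top (hregular hg))]

end multiplicity

end AdmissibleCycle

namespace AdmissiblePrime

open SimplexRing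

variable {A : Type*} [CommRing A] {n : ℕ}

theorem asIdeal_injective (p : ℕ) :
    Function.Injective fun P : AdmissiblePrime A p n => P.1.asIdeal :=
  fun _ _ h => Subtype.ext (PrimeSpectrum.ext h)

theorem eq_of_asIdeal_le {p : ℕ} {P Q : AdmissiblePrime A p n}
    (h : P.1.asIdeal ≤ Q.1.asIdeal) : P = Q := by
  have := P.1.isPrime
  have : P.1.asIdeal.FiniteHeight := by simp [Ideal.finiteHeight_iff, P.2.1]
  refine asIdeal_injective p (h.eq_or_lt.resolve_right fun hlt => ?_)
  have := Ideal.height_strict_mono_of_isPrime hlt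
  rw [P.2.1, Q.2.1] at this
  exact lt_irrefl _ this

theorem height_eq_one (P : AdmissiblePrime A 1 n) : P.1.asIdeal.height = 1 := by
  simpa using P.2.1

variable [IsDomain A]

/-- A point of codimension one is admissible if it does not specialize to the generic point of a
vertex of `Δⁿ`. -/
def ofVertex (P : PrimeSpectrum (SimplexRing A n)) (hP : P.asIdeal.height = 1)
    (h : ∀ j, ¬ P.asIdeal ≤ RingHom.ker (vertex A j)) : AdmissiblePrime A 1 n :=
  ⟨P, by simpa using hP, fun m φ Q hQ => by
    rw [Nat.cast_one, Order.one_le_iff_ne_zero]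
    intro h0
    rw [Ideal.height_eq_zero_iff_eq_bot] at h0
    refine h (φ 0) fun f hf => ?_
    have := hQ hf
    rw [h0, Ideal.mem_comap, Ideal.mem_bot] at this
    rw [RingHom.mem_ker, ← vertex_pull, this, map_zero]⟩

theorem not_le_ker_vertex (P : AdmissiblePrime A 1 n) (j : Fin (n + 1)) :
    ¬ P.1.asIdeal ≤ RingHom.ker (vertex A j) := by
  intro h
  let φ : Fin (0 + 1) ↪o Fin (n + 1) := OrderEmbedding.ofStrictMono (fun _ => j) fun a b hab =>
    absurd hab (Subsingleton.elim (α := Fin 1) a b).not_lt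
  have hcodim := P.2.2 0 φ ⟨⊥, Ideal.isPrime_bot⟩ fun f hf => by
    rw [Ideal.mem_comap, Ideal.mem_bot, ← algebraMap_vertex_zero (pull A φ f), vertex_pull]
    exact (congrArg _ (h hf)).trans (map_zero _)
  simp at hcodim

theorem vertex_ne_zero (P : AdmissiblePrime A 1 n) {f : SimplexRing A n}
    (hf : P.1.asIdeal = Ideal.span {f}) (j : Fin (n + 1)) : vertex A j f ≠ 0 := by
  intro h
  apply P.not_le_ker_vertex j
  rwa [hf, Ideal.span_singleton_le_iff_mem]

/-- The divisor of a prime element that vanishes at no vertex. -/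
def ofPrime [IsNoetherianRing A] (f : SimplexRing A n) (hf : Prime f)
    (h : ∀ j, vertex A j f ≠ 0) : AdmissiblePrime A 1 n :=
  ofVertex ⟨Ideal.span {f}, (Ideal.span_singleton_prime hf.ne_zero).2 hf⟩
    (Ideal.height_span_singleton_eq_one_of_mem_nonZeroDivisors
      (mem_nonZeroDivisors_of_ne_zero hf.ne_zero) hf.not_isUnit)
    fun j hj => h j (hj (Ideal.mem_span_singleton_self f))

variable [UniqueFactorizationMonoid A] (P : AdmissiblePrime A 1 n)

theorem exists_generator : ∃ f, Prime f ∧ P.1.asIdeal = Ideal.span {f} := by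
  have hprime := P.1.isPrime
  have hbot := P.1.asIdeal.ne_bot_of_height_eq_one P.height_eq_one
  obtain ⟨f, hfP, hf⟩ := hprime.exists_mem_prime_of_ne_bot hbot
  exact ⟨f, hf, P.1.asIdeal.eq_span_singleton_of_height_eq_one P.height_eq_one hfP hf⟩

/-- An equation of an admissible prime divisor. -/
def generator : SimplexRing A n :=
  P.exists_generator.choose

theorem asIdeal_eq_span_generator : P.1.asIdeal = Ideal.span {P.generator} :=
  P.exists_generator.choose_spec.2

end AdmissiblePrime

namespace AdmissibleCycle

open SimplexRing

section divisor

variable {A : Type*} [CommRing A] [IsNoetherianRing A] {n : ℕ}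

theorem face_single_apply (p : ℕ) (i : Fin (n + 2)) (P : AdmissiblePrime A p (n + 1))
    (Q : AdmissiblePrime A p n) :
    face A p n i (Finsupp.single P 1) Q =
      multiplicity (P.1.asIdeal.map (pull A i.succAbove)) Q.1 := by
  simp only [face, Finsupp.liftAddHom_apply_single, zmultiplesHom_apply, one_smul]
  rfl

variable [IsDomain A]

theorem finite_support_multiplicity {f : SimplexRing A n} (hf : f ≠ 0) :
    (Function.support fun Q : AdmissiblePrime A 1 n =>
      (multiplicity (Ideal.span {f}) Q.1 : ℤ)).Finite := by
  refine Set.Finite.of_finite_image (f := fun Q : AdmissiblePrime A 1 n => Q.1.asIdeal)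
    (((Ideal.span {f}).finite_minimalPrimes_of_isNoetherianRing _).subset ?_)
    (AdmissiblePrime.asIdeal_injective 1).injOn
  rintro _ ⟨Q, hQ, rfl⟩
  have hle : Ideal.span {f} ≤ Q.1.asIdeal := le_of_multiplicity_ne_zero (by simpa using hQ)
  have := Q.1.isPrime
  refine Ideal.mem_minimalPrimes_of_height_le hle ?_
  rw [Q.height_eq_one]
  exact Ideal.one_le_height_span_singleton_of_mem_nonZeroDivisors
    (mem_nonZeroDivisors_of_ne_zero hf)

/-- The divisor of a nonzero function. Components that are not admissible are left out. -/
def divisor (f : SimplexRing A n) (hf : f ≠ 0) : AdmissibleCycle A 1 n :=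
  Finsupp.ofSupportFinite _ (finite_support_multiplicity hf)

theorem divisor_apply (f : SimplexRing A n) (hf : f ≠ 0) (Q : AdmissiblePrime A 1 n) :
    divisor f hf Q = multiplicity (Ideal.span {f}) Q.1 :=
  rfl

theorem divisor_of_isUnit {f : SimplexRing A n} (hf : IsUnit f) : divisor f hf.ne_zero = 0 := by
  ext Q
  rw [divisor_apply, multiplicity_eq_zero_of_isUnit hf, Nat.cast_zero, Finsupp.zero_apply]

theorem divisor_mul {f g : SimplexRing A n} (hf : f ≠ 0) (hg : g ≠ 0) :
    divisor (f * g) (mul_ne_zero hf hg) = divisor f hf + divisor g hg := by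
  ext Q
  simp [divisor_apply, multiplicity_span_mul hf hg Q.height_eq_one.le]

theorem divisor_eq_single (P : AdmissiblePrime A 1 n) {f : SimplexRing A n} (hf : f ≠ 0)
    (hP : P.1.asIdeal = Ideal.span {f}) : divisor f hf = Finsupp.single P 1 := by
  classical
  ext Q
  rw [divisor_apply, Finsupp.single_apply]
  split_ifs with h
  · rw [← h, ← hP, multiplicity_self, Nat.cast_one]
  · rw [multiplicity_eq_zero_of_notMem, Nat.cast_zero]
    intro hfQ
    exact h (AdmissiblePrime.eq_of_asIdeal_le
      (by rwa [hP, Ideal.span_singleton_le_iff_mem]))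

theorem face_single (i : Fin (n + 2)) (P : AdmissiblePrime A 1 (n + 1))
    {f : SimplexRing A (n + 1)} (hf : P.1.asIdeal = Ideal.span {f}) :
    face A 1 n i (Finsupp.single P 1) =
      divisor (pull A i.succAbove f) (pull_ne_zero (P.vertex_ne_zero hf) _) := by
  ext Q
  rw [face_single_apply, divisor_apply, hf, Ideal.map_span, Set.image_singleton]

end divisor

/-! ### The ratio of the values at the ends of `Δ¹` -/

section toUnits

variable {A : Type*} [CommRing A] [IsDomain A] [UniqueFactorizationMonoid A]
  (K : Type*) [Field K] [Algebra A K] [FaithfulSMul A K]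

/-- The homomorphism that takes a prime divisor on `Δ¹` with the equation `f` to `f(1) / f(0)`. -/
def toUnits : AdmissibleCycle A 1 1 →+ Additive Kˣ :=
  Finsupp.liftAddHom fun P => zmultiplesHom _ <| .ofMul <|
    Units.mk0 (vertexRatio K P.generator)
      (vertexRatio_ne_zero K (P.vertex_ne_zero P.asIdeal_eq_span_generator))

theorem toUnits_single (P : AdmissiblePrime A 1 1) {f : SimplexRing A 1}
    (hf : P.1.asIdeal = Ideal.span {f}) :
    ((toUnits K (Finsupp.single P 1)).toMul : K) = vertexRatio K f := by
  obtain ⟨u, rfl⟩ : Associated P.generator f := by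
    rw [← Ideal.span_singleton_eq_span_singleton, ← hf, P.asIdeal_eq_span_generator]
  simp [toUnits, vertexRatio_of_isUnit K u.isUnit]

variable [IsNoetherianRing A]

theorem toUnits_divisor {f : SimplexRing A 1} (hf : ∀ j, vertex A j f ≠ 0) :
    ((toUnits K (divisor f (ne_zero_of_vertex_ne_zero (hf 0)))).toMul : K) =
      vertexRatio K f := by
  induction f using UniqueFactorizationMonoid.induction_on_prime with
  | h₁ => exact absurd (map_zero _) (hf 0)
  | h₂ u hu => simp [divisor_of_isUnit hu, vertexRatio_of_isUnit K hu]
  | h₃ a p ha hp ih =>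
    have hpv (j) : vertex A j p ≠ 0 := fun h => hf j (by rw [map_mul, h, zero_mul])
    have hav (j) : vertex A j a ≠ 0 := fun h => hf j (by rw [map_mul, h, mul_zero])
    let P := AdmissiblePrime.ofPrime p hp hpv
    rw [divisor_mul hp.ne_zero ha, divisor_eq_single P hp.ne_zero rfl, map_add, toMul_add,
      Units.val_mul, ih hav, toUnits_single K P rfl, map_mul]

theorem toUnits_face_single (i : Fin 3) (P : AdmissiblePrime A 1 2) {f : SimplexRing A 2}
    (hf : P.1.asIdeal = Ideal.span {f}) :
    ((toUnits K (face A 1 1 i (Finsupp.single P 1))).toMul : K) =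
      algebraMap A K (vertex A (i.succAbove 1) f) /
        algebraMap A K (vertex A (i.succAbove 0) f) := by
  rw [face_single i P hf, ← vertexRatio_pull]
  exact toUnits_divisor K fun j => by simpa only [vertex_pull] using P.vertex_ne_zero hf _

theorem toUnits_differential (z : AdmissibleCycle A 1 2) :
    toUnits K (differential A 1 1 z) = 0 := by
  suffices h : (toUnits K).comp (differential A 1 1) = 0 from DFunLike.congr_fun h z
  refine Finsupp.addHom_ext' fun P => AddMonoidHom.ext_int <|
    Additive.toMul.injective <| Units.ext ?_
  have hf := P.asIdeal_eq_span_generator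
  have hv (j) : algebraMap A K (vertex A j P.generator) ≠ 0 := by
    simpa using P.vertex_ne_zero hf j
  have h0 := hv 0
  have h1 := hv 1
  have h2 := hv 2
  have e0 := toUnits_face_single K 0 P hf
  have e1 := toUnits_face_single K 1 P hf
  have e2 := toUnits_face_single K 2 P hf
  have htelescope :
      ((toUnits K (differential A 1 1 (Finsupp.single P 1))).toMul : K) =
        algebraMap A K (vertex A 2 P.generator) / algebraMap A K (vertex A 1 P.generator) *
          (algebraMap A K (vertex A 2 P.generator) / algebraMap A K (vertex A 0 P.generator))⁻¹ *
          (algebraMap A K (vertex A 1 P.generator) / algebraMap A K (vertex A 0 P.generator)) := by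
    have hlast : Fin.succAbove (2 : Fin 3) 1 = 1 := rfl
    simp [differential, Fin.sum_univ_three, e0, e1, e2, hlast]
  refine htelescope.trans ?_
  rw [AddMonoidHom.zero_comp, AddMonoidHom.zero_apply, toMul_zero, Units.val_one]
  field_simp

theorem exists_toUnits_eq {a : A} (ha : a ≠ 0) :
    ∃ z : AdmissibleCycle A 1 1, ((toUnits K z).toMul : K) = algebraMap A K a :=
  ⟨_, (toUnits_divisor K (vertex_linearFunction_ne_zero ha)).trans
    (vertexRatio_linearFunction K a)⟩

end toUnits

end AdmissibleCycle

/-! ### Cycles of codimension zero -/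

section CodimensionZero

variable (A : Type*) [CommRing A] [IsDomain A]

instance (n : ℕ) : Unique (AdmissiblePrime A 0 n) where
  default := ⟨⟨⊥, Ideal.isPrime_bot⟩, by simp, by simp⟩
  uniq P := AdmissiblePrime.asIdeal_injective 0 <|
    Ideal.height_eq_zero_iff_eq_bot.1 (by simpa using P.2.1)

theorem AdmissiblePrime.default_asIdeal (n : ℕ) :
    (default : AdmissiblePrime A 0 n).1.asIdeal = ⊥ :=
  rfl

variable [IsNoetherianRing A]

theorem AdmissibleCycle.differential_codim_zero : differential A 0 0 = 0 := by
  refine Finsupp.addHom_ext' fun P => AddMonoidHom.ext_int ?_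
  obtain rfl := Subsingleton.elim P default
  ext
  simp [differential, Fin.sum_univ_two, face_single_apply, AdmissiblePrime.default_asIdeal,
    Ideal.map_bot]

/-- The Chow group of cycles of codimension zero on the spectrum of a domain is infinite cyclic:
the degree is the multiplicity of the generic point. -/
def HigherChow.degree : HigherChow A 0 0 ≃+ ℤ :=
  AddEquiv.ofBijective
    (QuotientAddGroup.lift _
      ((Finsupp.applyAddHom default).comp (AdmissibleCycle.closedCycles A 0 0).subtype) (by
        rintro c ⟨b, hb⟩
        have hc : c = 0 := by
          ext1
          simpa [AdmissibleCycle.differential_codim_zero] using hb.symm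
        simp [hc])) (by
    refine ⟨?_, fun m => ⟨QuotientAddGroup.mk ⟨Finsupp.single default m, trivial⟩, ?_⟩⟩
    · rw [injective_iff_map_eq_zero]
      intro x hx
      induction x using QuotientAddGroup.induction_on with
      | H c =>
        have hc : c = 0 := Subtype.ext (Finsupp.unique_ext hx)
        rw [hc, QuotientAddGroup.mk_zero]
    · change Finsupp.single default m default = m
      simp)

theorem HigherChow.degree_mk (w : AdmissibleCycle.closedCycles A 0 0) :
    HigherChow.degree A (w : HigherChow A 0 0) = w.1 default :=
  rfl

end CodimensionZero

/-! ### Divisors over a field -/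

section Field

variable (k : Type*) [Field k]

instance : IsEmpty (AdmissiblePrime k 1 0) where
  false P := by
    obtain ⟨f, hf, hP⟩ := P.exists_generator
    apply hf.not_isUnit
    rw [← SimplexRing.algebraMap_vertex_zero f]
    exact (IsUnit.mk0 _ (P.vertex_ne_zero hP 0)).map _

instance : Subsingleton (HigherChow k 1 0) :=
  QuotientAddGroup.mk_surjective.subsingleton

theorem AdmissibleCycle.closedCycles_field : closedCycles k 1 1 = ⊤ :=
  top_le_iff.1 fun _ _ => Subsingleton.elim _ _

/-- The homomorphism `CH¹(k, 1) → kˣ` induced by `AdmissibleCycle.toUnits`. -/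
def HigherChow.toUnits : HigherChow k 1 1 →+ Additive kˣ :=
  QuotientAddGroup.lift _
    ((AdmissibleCycle.toUnits k).comp (AdmissibleCycle.closedCycles k 1 1).subtype) (by
      rintro c ⟨b, hb⟩
      change AdmissibleCycle.toUnits k c.1 = 0
      rw [← AdmissibleCycle.toUnits_differential k b]
      exact congrArg _ hb.symm)

theorem HigherChow.toUnits_surjective : Function.Surjective (HigherChow.toUnits k) := by
  intro u
  obtain ⟨z, hz⟩ := AdmissibleCycle.exists_toUnits_eq k u.toMul.ne_zero
  have hzu : AdmissibleCycle.toUnits k z = u := Additive.toMul.injective (Units.ext hz)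
  exact ⟨QuotientAddGroup.mk ⟨z, AdmissibleCycle.closedCycles_field k ▸ trivial⟩, hzu⟩

end Field

/-! ### Divisors over a discrete valuation ring -/

section DiscreteValuationRing

open AdmissibleCycle SimplexRing

variable (R : Type*) [CommRing R] [IsDomain R] [IsDiscreteValuationRing R]

/-- The closed point of the spectrum of a discrete valuation ring, as a point of `Δ⁰`. -/
abbrev closedSimplexPoint : PrimeSpectrum (SimplexRing R 0) :=
  PrimeSpectrum.comap (baseMap R (IsLocalRing.ResidueField R) 0)
    (default : AdmissiblePrime (IsLocalRing.ResidueField R) 0 0).1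

variable {R}

theorem mem_closedSimplexPoint {x : SimplexRing R 0} :
    x ∈ (closedSimplexPoint R).asIdeal ↔ vertex R 0 x ∈ IsLocalRing.maximalIdeal R := by
  have hinj : Function.Injective (vertex (IsLocalRing.ResidueField R) (0 : Fin (0 + 1))) :=
    (equivZero (IsLocalRing.ResidueField R)).injective
  rw [PrimeSpectrum.comap_asIdeal, Ideal.mem_comap, AdmissiblePrime.default_asIdeal, Ideal.mem_bot,
    ← map_eq_zero_iff _ hinj, vertex_baseMap]
  exact IsLocalRing.residue_eq_zero_iff _

theorem closedSimplexPoint_eq_span {π : R} (hπ : Irreducible π) :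
    (closedSimplexPoint R).asIdeal = Ideal.span {algebraMap R _ π} := by
  ext x
  rw [mem_closedSimplexPoint, hπ.maximalIdeal_eq, Ideal.mem_span_singleton,
    Ideal.mem_span_singleton]
  constructor
  · rintro ⟨y, hy⟩
    exact ⟨algebraMap R _ y, by rw [← map_mul, ← hy, algebraMap_vertex_zero]⟩
  · rintro ⟨y, rfl⟩
    simp

variable (R) in
theorem height_closedSimplexPoint : (closedSimplexPoint R).asIdeal.height = 1 := by
  obtain ⟨π, hπ⟩ := IsDiscreteValuationRing.exists_irreducible R
  have hp := prime_algebraMap hπ.prime 0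
  rw [closedSimplexPoint_eq_span hπ]
  exact Ideal.height_span_singleton_eq_one_of_mem_nonZeroDivisors
    (mem_nonZeroDivisors_of_ne_zero hp.ne_zero) hp.not_isUnit

instance : Unique (AdmissiblePrime R 1 0) where
  default := AdmissiblePrime.ofVertex (closedSimplexPoint R) (height_closedSimplexPoint R) (by
    intro j hj
    obtain ⟨π, hπ⟩ := IsDiscreteValuationRing.exists_irreducible R
    rw [closedSimplexPoint_eq_span hπ, Ideal.span_singleton_le_iff_mem, RingHom.mem_ker] at hj
    exact hπ.ne_zero (by simpa using hj))
  uniq P := AdmissiblePrime.eq_of_asIdeal_le fun x hx => by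
    refine mem_closedSimplexPoint.2 ?_
    rw [IsLocalRing.mem_maximalIdeal, mem_nonunits_iff]
    intro hu
    refine P.1.isPrime.ne_top (Ideal.eq_top_of_isUnit_mem _ hx ?_)
    rw [← algebraMap_vertex_zero x]
    exact hu.map _

variable (R) in
theorem AdmissiblePrime.default_val :
    (default : AdmissiblePrime R 1 0).1 = closedSimplexPoint R :=
  rfl

variable (R) (F : Type*) [Field F] [Algebra R F] [IsFractionRing R F]

/-- The normalized discrete valuation on the multiplicative group of the fraction field, in
additive notation. -/
def unitsOrd : Additive Fˣ →+ ℤ :=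
  AddMonoidHom.mk' (fun u => WithZero.log (Ring.ordFrac R (u.toMul : F))) fun u v => by
    rw [toMul_add, Units.val_mul, map_mul, WithZero.log_mul] <;> simp

theorem unitsOrd_apply (u : Additive Fˣ) :
    unitsOrd R F u = WithZero.log (Ring.ordFrac R (u.toMul : F)) :=
  rfl

theorem unitsOrd_surjective : Function.Surjective (unitsOrd R F) := by
  obtain ⟨π, hπ⟩ := IsDiscreteValuationRing.exists_irreducible R
  have hπF : algebraMap R F π ≠ 0 := by simpa using hπ.ne_zero
  have h : unitsOrd R F (.ofMul (Units.mk0 _ hπF)) = 1 := by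
    simp [unitsOrd_apply, Ring.ordFrac_irreducible hπ]
  exact fun m => ⟨m • .ofMul (Units.mk0 _ hπF), by rw [map_zsmul, h, smul_eq_mul, mul_one]⟩

variable {R}

theorem multiplicity_closedSimplexPoint {r : R} (hr : r ≠ 0) :
    (AdmissibleCycle.multiplicity (Ideal.span {algebraMap R (SimplexRing R 0) r})
        (closedSimplexPoint R) : ℤ) =
      WithZero.log (Ring.ordFrac R (algebraMap R F r)) := by
  have hne {a : R} (ha : a ≠ 0) : algebraMap R (SimplexRing R 0) a ≠ 0 :=
    (map_ne_zero_iff _ (equivZero R).symm.injective).2 ha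
  have hord {a : R} (ha : a ≠ 0) : Ring.ordFrac R (algebraMap R F a) ≠ 0 := by simpa using ha
  induction r using UniqueFactorizationMonoid.induction_on_prime with
  | h₁ => exact absurd rfl hr
  | h₂ u hu => simp [multiplicity_eq_zero_of_isUnit (hu.map _), Ring.ordFrac_of_isUnit hu]
  | h₃ a p ha hp ih =>
    rw [map_mul, multiplicity_span_mul (hne hp.ne_zero) (hne ha) (height_closedSimplexPoint R).le,
      Nat.cast_add, ih ha, map_mul, map_mul, WithZero.log_mul (hord hp.ne_zero) (hord ha),
      ← closedSimplexPoint_eq_span hp.irreducible, AdmissibleCycle.multiplicity_self,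
      Ring.ordFrac_irreducible hp.irreducible, WithZero.log_exp, Nat.cast_one]

theorem differential_apply_default (z : AdmissibleCycle R 1 1) :
    differential R 1 0 z default = unitsOrd R F (toUnits F z) := by
  suffices h : (Finsupp.applyAddHom default).comp (differential R 1 0) =
      (unitsOrd R F).comp (toUnits F) from DFunLike.congr_fun h z
  refine Finsupp.addHom_ext' fun P => AddMonoidHom.ext_int ?_
  have hf := P.asIdeal_eq_span_generator
  have hord (j) : Ring.ordFrac R (algebraMap R F (vertex R j P.generator)) ≠ 0 := by
    simpa using P.vertex_ne_zero hf j
  have hface (i : Fin 2) : face R 1 0 i (Finsupp.single P 1) default =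
      WithZero.log (Ring.ordFrac R (algebraMap R F (vertex R (i.succAbove 0) P.generator))) := by
    rw [face_single i P hf, divisor_apply, ← algebraMap_vertex_zero (pull R _ _), vertex_pull]
    exact multiplicity_closedSimplexPoint F (P.vertex_ne_zero hf _)
  calc differential R 1 0 (Finsupp.single P 1) default
      = WithZero.log (Ring.ordFrac R (algebraMap R F (vertex R 1 P.generator))) -
          WithZero.log (Ring.ordFrac R (algebraMap R F (vertex R 0 P.generator))) := by
        simp [differential, Fin.sum_univ_two, hface, sub_eq_add_neg]
    _ = unitsOrd R F (toUnits F (Finsupp.single P 1)) := by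
        rw [unitsOrd_apply, toUnits_single F P hf, vertexRatio_apply, map_div₀,
          WithZero.log_div (hord 1) (hord 0)]

instance : Subsingleton (HigherChow R 1 0) := by
  obtain ⟨π, hπ⟩ := IsDiscreteValuationRing.exists_irreducible R
  obtain ⟨z, hz⟩ := exists_toUnits_eq (FractionRing R) hπ.ne_zero
  have hdz : differential R 1 0 z default = 1 := by
    rw [differential_apply_default (FractionRing R), unitsOrd_apply, hz,
      Ring.ordFrac_irreducible hπ, WithZero.log_exp]
  refine subsingleton_of_forall_eq 0 fun x => ?_
  induction x using QuotientAddGroup.induction_on with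
  | H c =>
    rw [QuotientAddGroup.eq_zero_iff]
    refine ⟨c.1 default • z, Finsupp.unique_ext ?_⟩
    rw [map_zsmul, Finsupp.smul_apply, hdz, smul_eq_mul, mul_one]
    rfl

end DiscreteValuationRing

/-! ### Restriction to the generic fibre -/

namespace SimplexRing

variable {A : Type*} [CommRing A] (M : Submonoid A) {B : Type*} [CommRing B] [Algebra A B]
  [IsLocalization M B] {n : ℕ}

include M

theorem map_comap_baseMap (I : Ideal (SimplexRing B n)) :
    (I.comap (baseMap A B n)).map (baseMap A B n) = I := by
  let := (baseMap A B n).toAlgebra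
  have := isLocalization_baseMap M B n
  exact IsLocalization.map_under (M.map (algebraMap A (SimplexRing A n))) _ I

theorem height_comap_baseMap (I : Ideal (SimplexRing B n)) :
    (I.comap (baseMap A B n)).height = I.height := by
  let := (baseMap A B n).toAlgebra
  have := isLocalization_baseMap M B n
  exact IsLocalization.height_under (M.map (algebraMap A (SimplexRing A n))) I

theorem comap_baseMap_injective :
    Function.Injective (PrimeSpectrum.comap (baseMap A B n)) := by
  intro P Q h
  have hcomap : P.asIdeal.comap (baseMap A B n) = Q.asIdeal.comap (baseMap A B n) :=
    congrArg PrimeSpectrum.asIdeal h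
  refine PrimeSpectrum.ext ?_
  rw [← map_comap_baseMap M P.asIdeal, hcomap, map_comap_baseMap M]

theorem exists_comap_baseMap_eq (P : PrimeSpectrum (SimplexRing A n))
    (hP : ∀ a ∈ M, algebraMap A _ a ∉ P.asIdeal) :
    ∃ Q : PrimeSpectrum (SimplexRing B n), PrimeSpectrum.comap (baseMap A B n) Q = P := by
  let := (baseMap A B n).toAlgebra
  have := isLocalization_baseMap M B n
  have hd : Disjoint ((M.map (algebraMap A (SimplexRing A n)) :
      Submonoid (SimplexRing A n)) : Set (SimplexRing A n)) P.asIdeal := by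
    rw [Set.disjoint_left]
    rintro _ ⟨a, ha, rfl⟩
    exact hP a ha
  refine ⟨⟨P.asIdeal.map (baseMap A B n),
    IsLocalization.isPrime_of_isPrime_disjoint _ (SimplexRing B n) _ P.isPrime hd⟩, ?_⟩
  exact PrimeSpectrum.ext
    (IsLocalization.under_map_of_isPrime_disjoint _ (SimplexRing B n) P.isPrime hd)

end SimplexRing

section GenericFibre

open AdmissibleCycle SimplexRing

variable (R : Type*) [CommRing R] [IsDomain R] {F : Type*} [Field F] [Algebra R F]
  [IsFractionRing R F] {n : ℕ}

/-- The closure in `Spec R × Δⁿ` of an admissible divisor on the generic fibre. -/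
def AdmissiblePrime.closure (Q : AdmissiblePrime F 1 n) : AdmissiblePrime R 1 n :=
  AdmissiblePrime.ofVertex (PrimeSpectrum.comap (baseMap R F n) Q.1)
    ((height_comap_baseMap (nonZeroDivisors R) Q.1.asIdeal).trans Q.height_eq_one) fun j hj => by
      apply Q.not_le_ker_vertex j
      rw [← map_comap_baseMap (nonZeroDivisors R) Q.1.asIdeal, Ideal.map_le_iff_le_comap]
      intro x hx
      rw [Ideal.mem_comap, RingHom.mem_ker, vertex_baseMap, (hj hx : vertex R j x = 0), map_zero]

theorem AdmissiblePrime.closure_val (Q : AdmissiblePrime F 1 n) :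
    (Q.closure R).1 = PrimeSpectrum.comap (baseMap R F n) Q.1 :=
  rfl

theorem AdmissiblePrime.closure_injective :
    Function.Injective (AdmissiblePrime.closure R : AdmissiblePrime F 1 n → _) := fun _ _ h =>
  Subtype.ext (comap_baseMap_injective (nonZeroDivisors R) (congrArg Subtype.val h))

variable {R} in
theorem AdmissiblePrime.mem_range_closure (P : AdmissiblePrime R 1 n)
    (hP : ∀ r : R, r ≠ 0 → algebraMap R _ r ∉ P.1.asIdeal) :
    P ∈ Set.range (AdmissiblePrime.closure R : AdmissiblePrime F 1 n → _) := by
  obtain ⟨Q, hQ⟩ := exists_comap_baseMap_eq (B := F) (nonZeroDivisors R) P.1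
    fun r hr => hP r (nonZeroDivisors.ne_zero hr)
  refine ⟨AdmissiblePrime.ofVertex Q ?_ fun j hj => ?_, Subtype.ext hQ⟩
  · rw [← height_comap_baseMap (nonZeroDivisors R) Q.asIdeal]
    exact (congrArg (fun P => P.asIdeal.height) hQ).trans P.height_eq_one
  · apply P.not_le_ker_vertex j
    rw [← hQ]
    intro x hx
    apply FaithfulSMul.algebraMap_injective R F
    rw [map_zero]
    exact (vertex_baseMap j x).symm.trans (hj hx)

theorem AdmissibleCycle.toPoints_mapDomain_closure (ξ : AdmissibleCycle F 1 n)
    (Q : PrimeSpectrum (SimplexRing F n)) :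
    toPoints (ξ.mapDomain (AdmissiblePrime.closure R)) (PrimeSpectrum.comap (baseMap R F n) Q) =
      ξ.toPoints Q := by
  have : toPoints (ξ.mapDomain (AdmissiblePrime.closure R)) =
      ξ.toPoints.mapDomain (PrimeSpectrum.comap (baseMap R F n)) :=
    Finsupp.mapDomain_comp.symm.trans (Finsupp.mapDomain_comp (v := ξ)
      (f := fun P : AdmissiblePrime F 1 n => P.1) (g := PrimeSpectrum.comap (baseMap R F n)))
  rw [this, Finsupp.mapDomain_apply (comap_baseMap_injective (nonZeroDivisors R))]

variable [UniqueFactorizationMonoid R]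

theorem AdmissibleCycle.toUnits_mapDomain_closure (ξ : AdmissibleCycle F 1 1) :
    toUnits F (ξ.mapDomain (AdmissiblePrime.closure R)) = toUnits F ξ := by
  suffices h : (toUnits F).comp (Finsupp.mapDomain.addMonoidHom (AdmissiblePrime.closure R)) =
      toUnits F from DFunLike.congr_fun h ξ
  refine Finsupp.addHom_ext' fun Q => AddMonoidHom.ext_int <|
    Additive.toMul.injective <| Units.ext ?_
  have hf := (Q.closure R).asIdeal_eq_span_generator
  have hQ : Q.1.asIdeal = Ideal.span {baseMap R F 1 (Q.closure R).generator} := by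
    refine (map_comap_baseMap (nonZeroDivisors R) Q.1.asIdeal).symm.trans ?_
    have h := congrArg (Ideal.map (baseMap R F 1)) hf
    rwa [Ideal.map_span, Set.image_singleton] at h
  calc ((toUnits F (Finsupp.mapDomain (AdmissiblePrime.closure R) (Finsupp.single Q 1))).toMul : F)
      = vertexRatio F (Q.closure R).generator := by
        rw [Finsupp.mapDomain_single, toUnits_single F _ hf]
    _ = (toUnits F (Finsupp.single Q 1)).toMul := by
        rw [toUnits_single F Q hQ, vertexRatio_baseMap]

variable {R}

theorem AdmissibleCycle.toUnits_single_of_notMem_range_closure (P : AdmissiblePrime R 1 1)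
    (hP : P ∉ Set.range (AdmissiblePrime.closure R : AdmissiblePrime F 1 1 → _)) :
    toUnits F (Finsupp.single P 1) = 0 := by
  have hprime := P.1.isPrime
  have hbot : P.1.asIdeal.comap (algebraMap R _) ≠ ⊥ := by
    contrapose! hP
    refine P.mem_range_closure fun r hr hrP => hr ?_
    rwa [← Ideal.mem_bot, ← hP]
  obtain ⟨p, hpP, hp⟩ := (hprime.comap (algebraMap R _)).exists_mem_prime_of_ne_bot hbot
  have hspan := P.1.asIdeal.eq_span_singleton_of_height_eq_one P.height_eq_one hpP
    (prime_algebraMap hp 1)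
  refine Additive.toMul.injective <| Units.ext ?_
  rw [toUnits_single F P hspan, vertexRatio_algebraMap F hp.ne_zero, toMul_zero, Units.val_one]

theorem AdmissibleCycle.toUnits_eq_of_restrict {z : AdmissibleCycle R 1 1}
    {ξ : AdmissibleCycle F 1 1}
    (h : ∀ Q, ξ.toPoints Q = z.toPoints (PrimeSpectrum.comap (baseMap R F 1) Q)) :
    toUnits F z = toUnits F ξ := by
  rw [← toUnits_mapDomain_closure R, ← sub_eq_zero, ← map_sub]
  set d := z - ξ.mapDomain (AdmissiblePrime.closure R) with hd
  have hclosure (Q : AdmissiblePrime F 1 1) : d (Q.closure R) = 0 := by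
    rw [hd, Finsupp.sub_apply, Finsupp.mapDomain_apply (AdmissiblePrime.closure_injective R),
      ← toPoints_val z, ← toPoints_val ξ, h Q.1, AdmissiblePrime.closure_val, sub_self]
  rw [← d.sum_single, Finsupp.sum, map_sum]
  refine Finset.sum_eq_zero fun P hP => ?_
  have hP' : P ∉ Set.range (AdmissiblePrime.closure R : AdmissiblePrime F 1 1 → _) := by
    rintro ⟨Q, rfl⟩
    exact Finsupp.mem_support_iff.1 hP (hclosure Q)
  rw [← mul_one (d P), ← smul_eq_mul, ← Finsupp.smul_single, map_zsmul,
    toUnits_single_of_notMem_range_closure P hP', smul_zero]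

end GenericFibre

/-! ### The boundary map -/

section Boundary

open AdmissibleCycle SimplexRing

variable (R : Type*) [CommRing R] [IsDomain R] [IsDiscreteValuationRing R]

variable {R} in
theorem toPoints_eq_mapDomain_iff (c : AdmissibleCycle R 1 0)
    (w : AdmissibleCycle (IsLocalRing.ResidueField R) 0 0) :
    c.toPoints = w.toPoints.mapDomain
      (PrimeSpectrum.comap (baseMap R (IsLocalRing.ResidueField R) 0)) ↔
    c default = w default := by
  have hc : c.toPoints = Finsupp.single (closedSimplexPoint R) (c default) := by
    conv_lhs => rw [Finsupp.unique_single c]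
    rw [toPoints_single, AdmissiblePrime.default_val]
  have hw : w.toPoints.mapDomain
      (PrimeSpectrum.comap (baseMap R (IsLocalRing.ResidueField R) 0)) =
      Finsupp.single (closedSimplexPoint R) (w default) := by
    conv_lhs => rw [Finsupp.unique_single w]
    rw [toPoints_single, Finsupp.mapDomain_single]
  rw [hc, hw]
  exact (Finsupp.single_injective _).eq_iff

variable (F : Type*) [Field F] [Algebra R F] [IsFractionRing R F]

/-- The order map `CH¹(η, 1) → ℤ`: the valuation of the associated element of `Fˣ`. -/
def HigherChow.order : HigherChow F 1 1 →+ ℤ :=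
  (unitsOrd R F).comp (HigherChow.toUnits F)

theorem HigherChow.order_mk (ξ : closedCycles F 1 1) :
    HigherChow.order R F (ξ : HigherChow F 1 1) = unitsOrd R F (AdmissibleCycle.toUnits F ξ.1) :=
  rfl

theorem HigherChow.order_surjective : Function.Surjective (HigherChow.order R F) :=
  (unitsOrd_surjective R F).comp (HigherChow.toUnits_surjective F)

/-- The boundary map of the localization sequence of a discrete valuation ring. -/
def localizationBoundary : HigherChow F 1 1 →+ HigherChow (IsLocalRing.ResidueField R) 0 0 :=
  (HigherChow.degree (IsLocalRing.ResidueField R)).symm.toAddMonoidHom.comp (HigherChow.order R F)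

theorem localizationBoundary_eq_iff {x : HigherChow F 1 1}
    {y : HigherChow (IsLocalRing.ResidueField R) 0 0} :
    localizationBoundary R F x = y ↔
      HigherChow.order R F x = HigherChow.degree (IsLocalRing.ResidueField R) y :=
  (HigherChow.degree (IsLocalRing.ResidueField R)).symm_apply_eq

theorem localizationBoundary_surjective : Function.Surjective (localizationBoundary R F) :=
  (HigherChow.degree (IsLocalRing.ResidueField R)).symm.surjective.comp
    (HigherChow.order_surjective R F)

theorem isLocalizationBoundary_localizationBoundary :
    IsLocalizationBoundary R F (localizationBoundary R F) := by
  intro x y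
  rw [localizationBoundary_eq_iff]
  constructor
  · induction x using QuotientAddGroup.induction_on with | H ξ
    induction y using QuotientAddGroup.induction_on with | H w
    intro h
    refine ⟨ξ.1.mapDomain (AdmissiblePrime.closure R), ξ, w, rfl, rfl,
      fun Q => (toPoints_mapDomain_closure R ξ.1 Q).symm, (toPoints_eq_mapDomain_iff _ w.1).2 ?_⟩
    rwa [differential_apply_default F, toUnits_mapDomain_closure, ← HigherChow.order_mk,
      ← HigherChow.degree_mk]
  · rintro ⟨z, ξ, w, rfl, rfl, hξ, hw⟩
    rw [HigherChow.order_mk, HigherChow.degree_mk, ← (toPoints_eq_mapDomain_iff _ w.1).1 hw,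
      differential_apply_default F, toUnits_eq_of_restrict hξ]

end Boundary

/-! ### The lattice -/

section Lattice

open LinearMap

section Extension

variable (M : Type*) [AddCommGroup M]

theorem isFullSublattice_range_tensorMk [Module.Finite ℤ M] :
    IsFullSublattice (range (TensorProduct.mk ℤ ℚ M 1)) := by
  have hfg : (range (TensorProduct.mk ℤ ℚ M 1)).FG := Module.Finite.iff_fg.1 inferInstance
  have hspan : Submodule.span ℚ (range (TensorProduct.mk ℤ ℚ M 1) : Set (ℚ ⊗[ℤ] M)) = ⊤ := by
    rw [← Submodule.map_top, ← Submodule.baseChange_eq_span, Submodule.baseChange_top]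
  exact ⟨hfg, hspan⟩

theorem finrank_range_tensorMk [Module.Flat ℤ M] :
    Module.finrank ℤ (range (TensorProduct.mk ℤ ℚ M 1)) = Module.finrank ℤ M :=
  finrank_range_of_inj (Module.Flat.tensorProduct_mk_injective ℤ M ℚ)

end Extension

section CodimensionZero

variable (A : Type*) [CommRing A] [IsDomain A] [IsNoetherianRing A]

instance : Module.Free ℤ (HigherChow A 0 0) :=
  Module.Free.of_equiv (HigherChow.degree A).symm.toIntLinearEquiv

instance : Module.Finite ℤ (HigherChow A 0 0) :=
  Module.Finite.equiv (HigherChow.degree A).symm.toIntLinearEquiv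

theorem HigherChow.finrank_codim_zero : Module.finrank ℤ (HigherChow A 0 0) = 1 := by
  rw [(HigherChow.degree A).toIntLinearEquiv.finrank_eq, Module.finrank_self]

end CodimensionZero

variable (R : Type*) [CommRing R] [IsDomain R] [IsDiscreteValuationRing R]

theorem finrank_deligneH1 : Module.finrank ℚ (DeligneH1 R) = 1 := by
  rw [Module.finrank_baseChange, HigherChow.finrank_codim_zero]

variable {R} {F : Type*} [Field F]
  {bd : HigherChow F 1 1 →+ HigherChow (IsLocalRing.ResidueField R) 0 0}

theorem range_regulator (hbd : Function.Surjective bd) :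
    range (regulator R F bd) =
      range (TensorProduct.mk ℤ ℚ (HigherChow (IsLocalRing.ResidueField R) 0 0) 1) :=
  range_comp_of_range_eq_top _ (range_eq_top.2 hbd)

theorem isFullSublattice_range_regulator (hbd : Function.Surjective bd) :
    IsFullSublattice (range (regulator R F bd)) :=
  range_regulator hbd ▸ isFullSublattice_range_tensorMk _

theorem finrank_range_regulator (hbd : Function.Surjective bd) :
    Module.finrank ℤ (range (regulator R F bd)) = 1 := by
  rw [range_regulator hbd]
  exact (finrank_range_tensorMk _).trans (HigherChow.finrank_codim_zero _)

theorem rationalRegulator_surjective (hbd : Function.Surjective bd) :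
    Function.Surjective (rationalRegulator R F bd) :=
  lTensor_surjective ℚ (g := bd.toIntLinearMap) hbd

end Lattice

/-! ### The local factor -/

section LFactor

theorem finrank_ellAdicH0 (E : Type*) [Field E] (ℓ : ℕ) [Fact ℓ.Prime] :
    Module.finrank ℚ_[ℓ] (EllAdicH0 E ℓ) = 1 := by
  have e : EllAdicH0 E ℓ ≃ₗ[ℚ_[ℓ]] ℚ_[ℓ] :=
    LinearEquiv.ofBijective (LocallyConstant.evalₗ ℚ_[ℓ] (default : PrimeSpectrum E)) (by
      refine ⟨fun f g h => ?_, fun c => ⟨LocallyConstant.const _ c, rfl⟩⟩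
      ext x
      rw [Subsingleton.elim x default]
      exact h)
  rw [e.finrank_eq, Module.finrank_self]

theorem det_id_sub_smul_id {k V : Type*} [Field k] [AddCommGroup V] [Module k V] (c : k) :
    LinearMap.det ((LinearMap.id : V →ₗ[k] V) - c • LinearMap.id) =
      (1 - c) ^ Module.finrank k V := by
  have h : (LinearMap.id : V →ₗ[k] V) - c • LinearMap.id = (1 - c) • LinearMap.id := by
    rw [sub_smul, one_smul]
  rw [h, LinearMap.det_smul, LinearMap.det_id, mul_one]

theorem galoisAction_eq_id (F : Type*) [Field F] (ℓ : ℕ) [Fact ℓ.Prime]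
    (σ : AlgebraicClosure F ≃ₐ[F] AlgebraicClosure F) :
    galoisAction F ℓ σ = LinearMap.id := by
  ext f x
  exact congrArg f (Subsingleton.elim _ _)

variable (R : Type*) [CommRing R] (F : Type*) [Field F] [Algebra R F]

theorem inertiaInvariants_eq_top (ℓ : ℕ) [Fact ℓ.Prime] : inertiaInvariants R F ℓ = ⊤ :=
  top_le_iff.1 fun f _ σ _ => by rw [galoisAction_eq_id, LinearMap.id_apply]

theorem finrank_inertiaInvariants (ℓ : ℕ) [Fact ℓ.Prime] :
    Module.finrank ℚ_[ℓ] (inertiaInvariants R F ℓ) = 1 := by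
  rw [inertiaInvariants_eq_top, finrank_top, finrank_ellAdicH0]

theorem localLFactor_eq [IsDomain R] [IsDiscreteValuationRing R] [IsFractionRing R F] (ℓ : ℕ)
    [Fact ℓ.Prime] (ι : ℚ_[ℓ] →+* ℂ) (σ : AlgebraicClosure F ≃ₐ[F] AlgebraicClosure F) (s : ℂ) :
    localLFactor R F ℓ ι σ s = (1 - (Nat.card (IsLocalRing.ResidueField R) : ℂ) ^ (-s))⁻¹ := by
  let := ι.toAlgebra
  have hrestrict : (galoisAction F ℓ σ).restrict
      (galoisAction_mem_inertiaInvariants R F ℓ σ) = LinearMap.id := by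
    ext1 f
    refine Subtype.ext ?_
    rw [LinearMap.coe_restrict_apply, galoisAction_eq_id, LinearMap.id_apply, LinearMap.id_apply]
  rw [localLFactor, hrestrict, LinearMap.baseChange_id, det_id_sub_smul_id,
    Module.finrank_baseChange, finrank_inertiaInvariants, pow_one]

theorem meromorphicOrderAt_inv_of_zero_of_deriv_ne_zero {𝕜 : Type*} [NontriviallyNormedField 𝕜]
    [CompleteSpace 𝕜] [CharZero 𝕜] {f : 𝕜 → 𝕜} {x : 𝕜} (hf : AnalyticAt 𝕜 f x) (hx : f x = 0)
    (hd : deriv f x ≠ 0) : meromorphicOrderAt f⁻¹ x = ((-1 : ℤ) : WithTop ℤ) := by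
  rw [meromorphicOrderAt_inv, hf.meromorphicOrderAt_eq,
    hf.analyticOrderAt_eq_one_of_zero_deriv_ne_zero hx hd]
  rfl

theorem meromorphicOrderAt_inv_one_sub_cpow_neg {c : ℂ} (hc₀ : c ≠ 0) (hc₁ : c ≠ 1) :
    meromorphicOrderAt (fun s : ℂ => (1 - c ^ (-s))⁻¹) 0 = ((-1 : ℤ) : WithTop ℤ) := by
  have hd (s : ℂ) : HasDerivAt (fun s : ℂ => 1 - c ^ (-s)) (c ^ (-s) * Complex.log c) s := by
    simpa using ((hasDerivAt_neg s).const_cpow (c := c) (Or.inl hc₀)).const_sub 1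
  have hlog : Complex.log c ≠ 0 := fun h =>
    hc₁ (by rw [← Complex.exp_log hc₀, h, Complex.exp_zero])
  refine meromorphicOrderAt_inv_of_zero_of_deriv_ne_zero
    (Differentiable.analyticAt (fun s => (hd s).differentiableAt) 0) (by simp) ?_
  simpa [(hd 0).deriv] using hlog

end LFactor

/-! ### The residue field of the completion at a finite place -/

section Residue

open IsDedekindDomain HeightOneSpectrum

variable {A : Type*} [CommRing A] [IsDedekindDomain A]
  (K : Type*) [Field K] [Algebra A K] [IsFractionRing A K] (v : HeightOneSpectrum A)

theorem mem_maximalIdeal_adicCompletionIntegers {x : v.adicCompletionIntegers K} :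
    x ∈ IsLocalRing.maximalIdeal (v.adicCompletionIntegers K) ↔
      Valued.v (x : v.adicCompletion K) < 1 := by
  rw [IsLocalRing.mem_maximalIdeal, mem_nonunits_iff,
    adicCompletionIntegers.isUnit_iff_valued_eq_one]
  exact (lt_iff_le_and_ne.trans (and_iff_right x.2)).symm

variable {K v}

theorem exists_valued_coe_sub_lt_one (x : v.adicCompletion K) :
    ∃ k : K, Valued.v ((k : v.adicCompletion K) - x) < 1 := by
  have hopen : IsOpen {y : v.adicCompletion K | Valued.v (y - x) < 1} := by
    have h := (Valued.isOpen_ball (v.adicCompletion K) 1).preimage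
      (continuous_id.sub continuous_const : Continuous fun y => y - x)
    simpa [Valuation.restrict_lt_one_iff] using h
  exact (denseRange_algebraMap K v).exists_mem_open hopen ⟨x, by simp⟩

theorem exists_valued_algebraMap_sub_lt_one (x : v.adicCompletionIntegers K) :
    ∃ a : A, Valued.v (algebraMap K (v.adicCompletion K) (algebraMap A K a) - x) < 1 := by
  obtain ⟨k, hk⟩ := exists_valued_coe_sub_lt_one (x : v.adicCompletion K)
  have hk1 : v.valuation K k ≤ 1 := by
    rw [← valuedAdicCompletion_eq_valuation', ← sub_add_cancel (k : v.adicCompletion K) x]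
    exact Valuation.map_add_le _ hk.le x.2
  obtain ⟨a, ha⟩ := exists_valuation_sub_lt_of_integer v hk1 1
  refine ⟨a, ?_⟩
  rw [← sub_add_sub_cancel _ (algebraMap K (v.adicCompletion K) k), ← map_sub]
  exact Valuation.map_add_lt _ ((valuedAdicCompletion_eq_valuation' v _).trans_lt ha) hk

variable (K v)

theorem residue_comp_algebraMap_surjective :
    Function.Surjective ((IsLocalRing.residue (v.adicCompletionIntegers K)).comp
      (algebraMap A (v.adicCompletionIntegers K))) := by
  intro y
  obtain ⟨x, rfl⟩ := IsLocalRing.residue_surjective y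
  obtain ⟨a, ha⟩ := exists_valued_algebraMap_sub_lt_one x
  refine ⟨a, ?_⟩
  rw [RingHom.comp_apply, ← sub_eq_zero, ← map_sub, IsLocalRing.residue_eq_zero_iff]
  exact (mem_maximalIdeal_adicCompletionIntegers K v).2 ha

theorem finite_residueField_adicCompletionIntegers [Finite (A ⧸ v.asIdeal)] :
    Finite (IsLocalRing.ResidueField (v.adicCompletionIntegers K)) := by
  let f := (IsLocalRing.residue (v.adicCompletionIntegers K)).comp
      (algebraMap A (v.adicCompletionIntegers K))
  have hf : ∀ a ∈ v.asIdeal, f a = 0 := by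
    intro a ha
    rw [RingHom.comp_apply, IsLocalRing.residue_eq_zero_iff,
      mem_maximalIdeal_adicCompletionIntegers]
    exact (valuedAdicCompletion_eq_valuation' v _).trans_lt ((v.valuation_lt_one_iff_mem a).2 ha)
  exact Finite.of_surjective _ (Ideal.Quotient.lift_surjective_of_surjective v.asIdeal hf
    (residue_comp_algebraMap_surjective K v))

end Residue

end

theorem mainTheorem1_general (R : Type*) [CommRing R] [IsDomain R] [IsDiscreteValuationRing R]
    [Finite (IsLocalRing.ResidueField R)] (F : Type*) [Field F] [Algebra R F]
    [IsFractionRing R F] :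
    Subsingleton (HigherChow R 1 0) ∧
    Subsingleton (HigherChow (IsLocalRing.ResidueField R) 1 0) ∧
    ∃ bd : HigherChow F 1 1 →+ HigherChow (IsLocalRing.ResidueField R) 0 0,
      IsLocalizationBoundary R F bd ∧
      Function.Surjective bd ∧
      Function.Surjective (rationalRegulator R F bd) ∧
      IsFullSublattice (LinearMap.range (regulator R F bd)) ∧
      Module.finrank ℤ (LinearMap.range (regulator R F bd)) = 1 ∧
      Module.finrank ℚ (DeligneH1 R) = 1 ∧
      meromorphicOrderAt
        (fun s : ℂ => (1 - (Nat.card (IsLocalRing.ResidueField R) : ℂ) ^ (-s))⁻¹) 0 =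
          ((-1 : ℤ) : WithTop ℤ) ∧
      ∀ (ℓ : ℕ) [Fact ℓ.Prime] (ι : ℚ_[ℓ] →+* ℂ)
          (σ : AlgebraicClosure F ≃ₐ[F] AlgebraicClosure F), IsGeometricFrobenius R F σ →
        (∀ s : ℂ, localLFactor R F ℓ ι σ s =
          (1 - (Nat.card (IsLocalRing.ResidueField R) : ℂ) ^ (-s))⁻¹) ∧
        meromorphicOrderAt (localLFactor R F ℓ ι σ) 0 =
          ((-(Module.finrank ℤ (LinearMap.range (regulator R F bd)) : ℤ) : ℤ) : WithTop ℤ) := by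
  have hsurj := localizationBoundary_surjective R F
  have hcard : 1 < Nat.card (IsLocalRing.ResidueField R) := Finite.one_lt_card
  have hpole := meromorphicOrderAt_inv_one_sub_cpow_neg
    (c := Nat.card (IsLocalRing.ResidueField R)) (by exact_mod_cast hcard.ne_bot)
    (by exact_mod_cast hcard.ne')
  refine ⟨inferInstance, inferInstance, localizationBoundary R F,
    isLocalizationBoundary_localizationBoundary R F, hsurj, rationalRegulator_surjective hsurj,
    isFullSublattice_range_regulator hsurj, finrank_range_regulator hsurj, finrank_deligneH1 R,
    hpole, fun ℓ _ ι σ _ => ⟨localLFactor_eq R F ℓ ι σ, ?_⟩⟩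
  rw [funext (localLFactor_eq R F ℓ ι σ), hpole, finrank_range_regulator hsurj, Nat.cast_one]

theorem mainTheorem1 (K : Type*) [Field K] [NumberField K]
    (v : IsDedekindDomain.HeightOneSpectrum (NumberField.RingOfIntegers K)) :
    -- `CH^1(Spec Λ)` and `CH^1(v)` vanish, so that `i^* i_* = 0` on `CH^0(v)`
    Subsingleton (HigherChow (v.adicCompletionIntegers K) 1 0) ∧
    Subsingleton
      (HigherChow (IsLocalRing.ResidueField (v.adicCompletionIntegers K)) 1 0) ∧
    -- the boundary map of the localization sequence
    ∃ bd : HigherChow (v.adicCompletion K) 1 1 →+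
        HigherChow (IsLocalRing.ResidueField (v.adicCompletionIntegers K)) 0 0,
      IsLocalizationBoundary (v.adicCompletionIntegers K) (v.adicCompletion K) bd ∧
      -- surjectivity of the regulator, integrally and rationally
      Function.Surjective bd ∧
      Function.Surjective
        (rationalRegulator (v.adicCompletionIntegers K) (v.adicCompletion K) bd) ∧
      -- its image is a full sublattice, of rank one, in a one-dimensional space
      IsFullSublattice
        (LinearMap.range (regulator (v.adicCompletionIntegers K) (v.adicCompletion K) bd)) ∧
      Module.finrank ℤ
        (LinearMap.range
          (regulator (v.adicCompletionIntegers K) (v.adicCompletion K) bd)) = 1 ∧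
      Module.finrank ℚ (DeligneH1 (v.adicCompletionIntegers K)) = 1 ∧
      -- the function `1 / (1 - N(v)^{-s})` has a pole of order one at `s = 0`
      meromorphicOrderAt (fun s : ℂ =>
        (1 - (Nat.card (IsLocalRing.ResidueField (v.adicCompletionIntegers K)) : ℂ) ^ (-s))⁻¹) 0
        = ((-1 : ℤ) : WithTop ℤ) ∧
      -- it is the local `L`-factor, whose pole order is the rank of the image
      ∀ (ℓ : ℕ) [Fact ℓ.Prime],
        (ℓ : IsLocalRing.ResidueField (v.adicCompletionIntegers K)) ≠ 0 →
        ∀ (ι : ℚ_[ℓ] →+* ℂ)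
          (σ : AlgebraicClosure (v.adicCompletion K) ≃ₐ[v.adicCompletion K]
            AlgebraicClosure (v.adicCompletion K)),
          IsGeometricFrobenius (v.adicCompletionIntegers K) (v.adicCompletion K) σ →
          (∀ s : ℂ,
            localLFactor (v.adicCompletionIntegers K) (v.adicCompletion K) ℓ ι σ s =
              (1 - (Nat.card (IsLocalRing.ResidueField (v.adicCompletionIntegers K)) : ℂ)
                ^ (-s))⁻¹) ∧
          meromorphicOrderAt
              (localLFactor (v.adicCompletionIntegers K) (v.adicCompletion K) ℓ ι σ) 0 =
            ((-(Module.finrank ℤ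
              (LinearMap.range
                (regulator (v.adicCompletionIntegers K) (v.adicCompletion K) bd)) : ℤ) : ℤ) :
              WithTop ℤ) := by
  have : Finite (NumberField.RingOfIntegers K ⧸ v.asIdeal) :=
    v.asIdeal.finiteQuotientOfFreeOfNeBot v.ne_bot
  have := finite_residueField_adicCompletionIntegers K v
  obtain ⟨hR, hk, bd, hbd, hsurj, hsurjℚ, hlattice, hrank, hdim, hpole, hL⟩ :=
    mainTheorem1_general (v.adicCompletionIntegers K) (v.adicCompletion K)
  exact ⟨hR, hk, bd, hbd, hsurj, hsurjℚ, hlattice, hrank, hdim, hpole, fun ℓ _ _ => hL ℓ⟩
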